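/- All graphs are finite and simple. For a graph $G$ with vertex set $V\neq\emptyset$, a dual orthonormal representation of $G$ in $\mathbb{R}^d$ is a family of unit vectors $u_i\in\mathbb{R}^d$ $(i\in V)$ such that $\langle u_i,u_j\rangle=0$ whenever $ij\in E(G)$. The complementary Lovász theta number of $G$ is $$\overline{\vartheta}(G)=\min_{d,\,u,\,c}\ \max_{i\in V}\frac{1}{\langle c,u_i\rangle^2},$$ where the minimum is over all dimensions $d\ge 1$, all dual orthonormal representations $u=(u_i)_{i\in V}$ of $G$ in $\mathbb{R}^d$ and all unit vectors $c\in\mathbb{R}^d$ (with $1/0=+\infty$). The Mycielskian $M(G)$ has vertex set $(V\times\{0,1\})\cup\{z\}$ and edges $\{(v,0),(w,i)\}$ for $vw\in E(G)$, $i\in\{0,1\}$, and $\{z,(v,1)\}$ for $v\in V$. **Theorem.** Let $G$ be a graph with at least one vertex and let $t=\overline{\vartheta}(G)$. The minima defining $\overline{\vartheta}(G)$ and $\overline{\vartheta}(M(G))$ are attained, and $$\overline{\vartheta}(M(G))=\frac43\,t\cos\left(\frac13\arccos\left(1-\frac{27}{4t}+\frac{27}{4t^2}\right)\right)-\frac13\,t+1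 .$$ Moreover, $\overline{\vartheta}(M(G))$ is the largest real root of the cubic $$x^3+(t-3)x^2+(3-2t-t^2)x+(-t^3+5t^2-3t-1)=0 .$$ -/

import Mathlib

/-- The Mycielskian `M(G)`. Its vertices are the pairs `(v, i)` with `v` a vertex of `G` and
`i ∈ {0, 1}`, together with one further vertex `z`, here `Sum.inr ()`. The edges are
`{(v, 0), (w, i)}` for `{v, w}` an edge of `G` and `i ∈ {0, 1}`, and `{z, (v, 1)}` for every `v`. -/
def mycielskian {V : Type*} (G : SimpleGraph V) : SimpleGraph ((V × Fin 2) ⊕ Unit) where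
  Adj a b :=
    match a, b with
    | Sum.inl (v, i), Sum.inl (w, j) => G.Adj v w ∧ (i = 0 ∨ j = 0)
    | Sum.inl (_, i), Sum.inr _ => i = 1
    | Sum.inr _, Sum.inl (_, j) => j = 1
    | Sum.inr _, Sum.inr _ => False
  symm := ⟨by
    rintro (⟨v, i⟩ | z) (⟨w, j⟩ | z') h
    · exact ⟨h.1.symm, h.2.symm⟩
    · exact h
    · exact h
    · exact h⟩
  loopless := ⟨by
    rintro (⟨v, i⟩ | z) h
    · exact G.irrefl h.1
    · exact h⟩

/-- An orthonormal representation of `G` in `ℝ^d`: unit vectors, orthogonal for any two distinct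
non-adjacent vertices. -/
def IsOrthonormalRep {V : Type*} (G : SimpleGraph V) {d : ℕ}
    (u : V → EuclideanSpace ℝ (Fin d)) : Prop :=
  (∀ i, ‖u i‖ = 1) ∧ ∀ i j, i ≠ j → ¬ G.Adj i j → inner ℝ (u i) (u j) = 0

/-- A dual orthonormal representation of `G` is an orthonormal representation of its complement. -/
def IsDualOrthonormalRep {V : Type*} (G : SimpleGraph V) {d : ℕ}
    (u : V → EuclideanSpace ℝ (Fin d)) : Prop :=
  IsOrthonormalRep Gᶜ u

/-- The finite values of `max_i 1 / ⟨c, u_i⟩²`, where `u` runs over the dual orthonormal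
representations of `G`, in any dimension `d`, and `c` over the unit vectors of `ℝ^d`. If some
`⟨c, u_i⟩` vanishes the maximum is `+∞`, so such pairs contribute nothing to the minimum. -/
def thetaBarValues {V : Type*} (G : SimpleGraph V) : Set ℝ :=
  {r | ∃ (d : ℕ) (u : V → EuclideanSpace ℝ (Fin d)) (c : EuclideanSpace ℝ (Fin d)),
    IsDualOrthonormalRep G u ∧ ‖c‖ = 1 ∧ (∀ i, inner ℝ c (u i) ≠ 0) ∧
    IsGreatest (Set.range fun i => 1 / (inner ℝ c (u i)) ^ 2) r}

/-- The complementary Lovász theta number, the minimum of `thetaBarValues G`. -/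
noncomputable def thetaBar {V : Type*} (G : SimpleGraph V) : ℝ :=
  sInf (thetaBarValues G)

/-!
The theta number `t` of `G` is the least `t` for which `G` has a strict vector `t`-colouring, and
this semidefinite program has no duality gap. An optimal colouring of `G`, with vectors `y`, and an
optimal dual matrix of `G`, with Gram vectors `g` and Gram vectors `f` of its slack matrix, both
lift to the Mycielskian: the vectors at the two levels are multiples of the old ones, and each
lifted matrix is a sum of a few such Gram matrices. The multiples can be chosen such that both lifts
are feasible, with the same value `u + 1`, provided that `(u + t)² (t - u) = 4 t (t - 1)` and
`t - 1 < u ≤ t`. This is the cubic in `x = u + 1`, and the triple-angle formula for the cosine gives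
a root with `t / 3 ≤ u`, a range on which the left-hand side is strictly decreasing.
-/

open Matrix

section PosSemidef

variable {V : Type*}

theorem exists_eq_gram_of_posSemidef [Finite V] {A : Matrix V V ℝ} (hA : A.PosSemidef) :
    ∃ (m : ℕ) (y : V → EuclideanSpace ℝ (Fin m)), A = gram ℝ y := by
  obtain ⟨m, v, rfl⟩ := posSemidef_iff_eq_sum_vecMulVec.mp hA
  refine ⟨m, fun i => WithLp.toLp 2 fun k => v k i, ?_⟩
  ext i j
  simp [Matrix.sum_apply, vecMulVec_apply, gram_apply, PiLp.inner_apply, mul_comm]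

theorem sum_sum_gram [Fintype V] {E : Type*} [NormedAddCommGroup E] [InnerProductSpace ℝ E]
    (x : V → E) : ∑ i, ∑ j, gram ℝ x i j = ‖∑ i, x i‖ ^ 2 := by
  simp only [gram_apply, ← inner_sum, ← sum_inner, real_inner_self_eq_norm_sq]

theorem abs_apply_le_of_posSemidef [Finite V] {A : Matrix V V ℝ} (hA : A.PosSemidef) {C : ℝ}
    (hC : ∀ i, A i i ≤ C) (i j : V) : |A i j| ≤ C := by
  obtain ⟨m, y, rfl⟩ := exists_eq_gram_of_posSemidef hA
  simp only [gram_apply, real_inner_self_eq_norm_sq] at hC ⊢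
  calc |inner ℝ (y i) (y j)| ≤ ‖y i‖ * ‖y j‖ := abs_real_inner_le_norm _ _
    _ ≤ C := by nlinarith [hC i, hC j, sq_nonneg (‖y i‖ - ‖y j‖)]

theorem isClosed_setOf_posSemidef [Finite V] : IsClosed {A : Matrix V V ℝ | A.PosSemidef} := by
  have := Fintype.ofFinite V
  simp only [posSemidef_iff_dotProduct_mulVec, Set.ofPred_and, Set.ofPred_forall, IsHermitian]
  exact (isClosed_eq (by fun_prop) continuous_id).inter
    (isClosed_iInter fun x => isClosed_le continuous_const (by fun_prop))

theorem isCompact_setOf_posSemidef_diag_le [Finite V] (C : ℝ) :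
    IsCompact {A : Matrix V V ℝ | A.PosSemidef ∧ ∀ i, A i i ≤ C} := by
  have hbox : IsCompact
      (Set.univ.pi fun _ => Set.univ.pi fun _ => Set.Icc (-C) C : Set (Matrix V V ℝ)) :=
    isCompact_univ_pi fun _ => isCompact_univ_pi fun _ => isCompact_Icc
  refine hbox.of_isClosed_subset ?_ fun A hA i _ j _ =>
    abs_le.1 (abs_apply_le_of_posSemidef hA.1 hA.2 i j)
  simp only [Set.ofPred_and, Set.ofPred_forall]
  exact isClosed_setOf_posSemidef.inter
    (isClosed_iInter fun i => isClosed_le (by fun_prop) continuous_const)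

variable [Fintype V]

theorem isCompact_setOf_posSemidef_trace_eq_one :
    IsCompact {B : Matrix V V ℝ | B.PosSemidef ∧ B.trace = 1} := by
  refine (isCompact_setOf_posSemidef_diag_le 1).of_isClosed_subset ?_ fun B ⟨hB, htr⟩ =>
    ⟨hB, fun i => htr ▸ Finset.single_le_sum (f := B.diag) (fun j _ => hB.diag_nonneg)
      (Finset.mem_univ i)⟩
  rw [Set.ofPred_and]
  exact isClosed_setOf_posSemidef.inter (isClosed_eq (by fun_prop) continuous_const)

theorem convex_setOf_posSemidef_trace_eq_one :
    Convex ℝ {B : Matrix V V ℝ | B.PosSemidef ∧ B.trace = 1} := by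
  rintro A ⟨hA, hA1⟩ B ⟨hB, hB1⟩ a b ha hb hab
  exact ⟨(hA.smul ha).add (hB.smul hb), by simp [hA1, hB1, hab]⟩

theorem le_mul_trace_of_forall_trace_eq_one {f : Matrix V V ℝ →ₗ[ℝ] ℝ} {a : ℝ}
    (hf : ∀ B : Matrix V V ℝ, B.PosSemidef → B.trace = 1 → f B ≤ a) {B : Matrix V V ℝ}
    (hB : B.PosSemidef) : f B ≤ a * B.trace := by
  rcases hB.trace_nonneg.eq_or_lt with h0 | hpos
  · simp [hB.trace_eq_zero_iff.1 h0.symm]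
  · have h := hf (B.trace⁻¹ • B) (hB.smul (inv_nonneg.2 hpos.le)) (by simp [hpos.ne'])
    rwa [map_smul, smul_eq_mul, inv_mul_le_iff₀ hpos, mul_comm] at h

theorem apply_vecMulVec_eq_sum [DecidableEq V] (f : Matrix V V ℝ →ₗ[ℝ] ℝ) (x y : V → ℝ) :
    f (vecMulVec x y) = ∑ i, ∑ j, x i * y j * f (Matrix.single i j 1) := by
  conv_lhs => rw [matrix_eq_sum_single (vecMulVec x y)]
  simp only [map_sum, vecMulVec_apply]
  refine Finset.sum_congr rfl fun i _ => Finset.sum_congr rfl fun j _ => ?_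
  rw [← smul_eq_mul (x i * y j), ← map_smul, smul_single, smul_eq_mul, mul_one]

theorem posSemidef_smul_one_sub_of_le_mul_trace [DecidableEq V] {f : Matrix V V ℝ →ₗ[ℝ] ℝ}
    {a : ℝ} (hf : ∀ B : Matrix V V ℝ, B.PosSemidef → f B ≤ a * B.trace) :
    (a • 1 - of fun i j => (f (Matrix.single i j 1) + f (Matrix.single j i 1)) / 2 :
      Matrix V V ℝ).PosSemidef := by
  refine .of_dotProduct_mulVec_nonneg ?_ fun x => ?_
  · ext i j
    simp [one_apply, eq_comm, add_comm]
  · have hswap : ∑ i, ∑ j, x i * x j * f (Matrix.single j i 1) = f (vecMulVec x x) := by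
      rw [apply_vecMulVec_eq_sum, Finset.sum_comm]
      exact Finset.sum_congr rfl fun i _ => Finset.sum_congr rfl fun j _ => by rw [mul_comm (x j)]
    have hquad : star x ⬝ᵥ (of fun i j =>
        (f (Matrix.single i j 1) + f (Matrix.single j i 1)) / 2) *ᵥ x = f (vecMulVec x x) := by
      calc _ = ∑ i, ∑ j, (x i * x j * f (Matrix.single i j 1) +
            x i * x j * f (Matrix.single j i 1)) / 2 := by
            simp only [dotProduct, mulVec, of_apply, star_trivial, Finset.mul_sum]
            exact Finset.sum_congr rfl fun i _ => Finset.sum_congr rfl fun j _ => by ring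
        _ = f (vecMulVec x x) := by
            simp only [← Finset.sum_div, Finset.sum_add_distrib, hswap,
              ← apply_vecMulVec_eq_sum, add_self_div_two]
    have hx : (vecMulVec x x).PosSemidef := by
      simpa using posSemidef_vecMulVec_self_star x
    have h := hf _ hx
    rw [trace_vecMulVec] at h
    rw [sub_mulVec, dotProduct_sub, hquad, smul_mulVec, one_mulVec, dotProduct_smul, star_trivial,
      smul_eq_mul]
    exact sub_nonneg.2 h

end PosSemidef

/-- A strict vector `t`-colouring of `G`, given by the Gram matrix `Y` of its vectors, which are
scaled to squared length `t - 1` so that the inner products along edges become `-1`. -/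
structure IsStrictVectorColoring {V : Type*} (G : SimpleGraph V) (t : ℝ) (Y : Matrix V V ℝ) :
    Prop where
  posSemidef : Y.PosSemidef
  diag_eq : ∀ i, Y i i = t - 1
  adj_eq : ∀ i j, G.Adj i j → Y i j = -1

/-- The feasible matrices of the semidefinite program dual to minimising `t` over the strict vector
`t`-colourings of `G`, without the normalisation of the trace. -/
structure IsThetaDual {V : Type*} (G : SimpleGraph V) (B : Matrix V V ℝ) : Prop where
  posSemidef : B.PosSemidef
  eq_zero_of_not_adj : ∀ i j, i ≠ j → ¬ G.Adj i j → B i j = 0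

section ThetaBar

variable {V : Type*} {G : SimpleGraph V}

theorem IsStrictVectorColoring.one_le [Nonempty V] {t : ℝ} {Y : Matrix V V ℝ}
    (hY : IsStrictVectorColoring G t Y) : 1 ≤ t := by
  obtain ⟨i⟩ := ‹Nonempty V›
  have := hY.posSemidef.diag_nonneg (i := i)
  linarith [hY.diag_eq i]

theorem exists_isStrictVectorColoring_of_diag_le {t : ℝ} {Y : Matrix V V ℝ}
    (hY : Y.PosSemidef) (hdiag : ∀ i, Y i i ≤ t - 1) (hadj : ∀ i j, G.Adj i j → Y i j = -1) :
    ∃ Z, IsStrictVectorColoring G t Z := by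
  classical
  refine ⟨Y + diagonal fun i => t - 1 - Y i i,
    hY.add (.diagonal fun i => sub_nonneg.2 (hdiag i)), fun i => by simp, fun i j hij => ?_⟩
  simp [hij.ne, hadj i j hij]

theorem exists_isStrictVectorColoring_of_mem_thetaBarValues [Finite V] {t : ℝ}
    (ht : t ∈ thetaBarValues G) : ∃ Y, IsStrictVectorColoring G t Y := by
  obtain ⟨d, u, c, ⟨hunit, horth⟩, hc, hne, hmax⟩ := ht
  let y : V → EuclideanSpace ℝ (Fin d) := fun i => (inner ℝ c (u i))⁻¹ • u i - c
  have hinner : ∀ i j, inner ℝ (y i) (y j) =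
      inner ℝ (u i) (u j) / (inner ℝ c (u i) * inner ℝ c (u j)) - 1 := by
    intro i j
    have hi := hne i
    have hj := hne j
    simp only [y, inner_sub_left, inner_sub_right, real_inner_smul_left, real_inner_smul_right,
      real_inner_self_eq_norm_sq, hc, real_inner_comm c (u i)]
    field_simp
    ring
  refine exists_isStrictVectorColoring_of_diag_le (posSemidef_gram ℝ y) (fun i => ?_)
    fun i j hij => ?_
  · rw [gram_apply, hinner, real_inner_self_eq_norm_sq, hunit, one_pow, ← sq]
    exact sub_le_sub_right (hmax.2 ⟨i, rfl⟩) 1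
  · rw [gram_apply, hinner, horth i j hij.ne (by simp [hij]), zero_div, zero_sub]

theorem IsStrictVectorColoring.mem_thetaBarValues [Finite V] [Nonempty V] {t : ℝ}
    {Y : Matrix V V ℝ} (hY : IsStrictVectorColoring G t Y) : t ∈ thetaBarValues G := by
  have ht : 0 < t := zero_lt_one.trans_le hY.one_le
  obtain ⟨m, y, rfl⟩ := exists_eq_gram_of_posSemidef hY.posSemidef
  let w : V → EuclideanSpace ℝ (Fin (m + 1)) := fun i => WithLp.toLp 2 (vecCons 1 (y i))
  let u : V → EuclideanSpace ℝ (Fin (m + 1)) := fun i => (√t)⁻¹ • w i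
  have hw : ∀ i j, inner ℝ (w i) (w j) = 1 + inner ℝ (y i) (y j) := fun i j => by
    simp [w, PiLp.inner_apply, Fin.sum_univ_succ]
  have hinner : ∀ i j, inner ℝ (u i) (u j) = (1 + inner ℝ (y i) (y j)) / t := fun i j => by
    rw [real_inner_smul_left, real_inner_smul_right, hw, ← mul_assoc, ← mul_inv,
      Real.mul_self_sqrt ht.le, div_eq_inv_mul]
  have hc : ∀ i, inner ℝ (EuclideanSpace.single 0 1) (u i) = (√t)⁻¹ := fun i => by
    rw [real_inner_smul_right, EuclideanSpace.inner_single_left]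
    simp [w]
  refine ⟨m + 1, u, EuclideanSpace.single 0 1, ⟨fun i => ?_, fun i j hij hadj => ?_⟩, by simp,
    fun i => ?_, ?_⟩
  · rw [← sq_eq_sq₀ (norm_nonneg _) zero_le_one, ← real_inner_self_eq_norm_sq, hinner,
      ← gram_apply (𝕜 := ℝ) y, hY.diag_eq, add_sub_cancel, div_self ht.ne', one_pow]
  · have hG : G.Adj i j := by simpa [hij] using hadj
    rw [hinner, ← gram_apply (𝕜 := ℝ) y, hY.adj_eq i j hG, add_neg_cancel, zero_div]
  · rw [hc]
    exact inv_ne_zero (Real.sqrt_pos.2 ht).ne'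
  · simp only [hc, inv_pow, Real.sq_sqrt ht.le, one_div, inv_inv, Set.range_const]
    exact isGreatest_singleton

theorem mem_thetaBarValues_iff [Finite V] [Nonempty V] {t : ℝ} :
    t ∈ thetaBarValues G ↔ ∃ Y, IsStrictVectorColoring G t Y :=
  ⟨exists_isStrictVectorColoring_of_mem_thetaBarValues, fun ⟨_, hY⟩ => hY.mem_thetaBarValues⟩

theorem isStrictVectorColoring_card [Fintype V] [DecidableEq V] (G : SimpleGraph V) :
    IsStrictVectorColoring G (Fintype.card V) ((⊤ : SimpleGraph V).lapMatrix ℝ) where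
  posSemidef := SimpleGraph.posSemidef_lapMatrix ℝ ⊤
  diag_eq i := by
    have : Nonempty V := ⟨i⟩
    simp [SimpleGraph.lapMatrix, SimpleGraph.degMatrix, Nat.cast_sub Fintype.card_pos]
  adj_eq i j hij := by simp [SimpleGraph.lapMatrix, SimpleGraph.degMatrix, hij.ne]

theorem exists_isLeast_thetaBarValues [Finite V] [Nonempty V] (G : SimpleGraph V) :
    ∃ t, IsLeast (thetaBarValues G) t := by
  classical
  have := Fintype.ofFinite V
  obtain ⟨v⟩ := id ‹Nonempty V›
  let C : ℝ := Fintype.card V - 1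
  let K : Set (Matrix V V ℝ) := {Y | Y.PosSemidef ∧ ∀ i, Y i i ≤ C} ∩
    {Y | (∀ i, Y i i = Y v v) ∧ ∀ i j, G.Adj i j → Y i j = -1}
  have hK : IsCompact K := by
    refine (isCompact_setOf_posSemidef_diag_le C).inter_right ?_
    simp only [Set.ofPred_and, Set.ofPred_forall]
    exact (isClosed_iInter fun i => isClosed_eq (by fun_prop) (by fun_prop)).inter
      (isClosed_iInter fun i => isClosed_iInter fun j => isClosed_iInter fun _ =>
        isClosed_eq (by fun_prop) continuous_const)
  have hmem : ∀ {t Y}, IsStrictVectorColoring G t Y → t - 1 ≤ C → Y ∈ K := fun hY ht =>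
    ⟨⟨hY.posSemidef, fun i => (hY.diag_eq i).trans_le ht⟩,
      fun i => (hY.diag_eq i).trans (hY.diag_eq v).symm, hY.adj_eq⟩
  have hL := isStrictVectorColoring_card G
  obtain ⟨Y, ⟨⟨hY, hYC⟩, hdiag, hadj⟩, hmin⟩ := hK.exists_isMinOn ⟨_, hmem hL le_rfl⟩
    (f := fun Y => Y v v) (by fun_prop)
  refine ⟨Y v v + 1, mem_thetaBarValues_iff.2 ⟨Y, hY, fun i => by simp [hdiag i], hadj⟩,
    fun t ht => ?_⟩
  obtain ⟨Z, hZ⟩ := mem_thetaBarValues_iff.1 ht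
  rcases le_total (t - 1) C with htC | htC
  · have : Y v v ≤ Z v v := hmin (hmem hZ htC)
    linarith [hZ.diag_eq v]
  · linarith [hYC v]

theorem isLeast_thetaBar [Finite V] [Nonempty V] (G : SimpleGraph V) :
    IsLeast (thetaBarValues G) (thetaBar G) := by
  obtain ⟨t, ht⟩ := exists_isLeast_thetaBarValues G
  rwa [thetaBar, ht.csInf_eq]

theorem exists_isStrictVectorColoring_thetaBar [Finite V] [Nonempty V] (G : SimpleGraph V) :
    ∃ Y, IsStrictVectorColoring G (thetaBar G) Y :=
  mem_thetaBarValues_iff.1 (isLeast_thetaBar G).1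

theorem one_le_thetaBar [Finite V] [Nonempty V] (G : SimpleGraph V) : 1 ≤ thetaBar G :=
  let ⟨_, hY⟩ := exists_isStrictVectorColoring_thetaBar G
  hY.one_le

end ThetaBar

section Duality

variable {V : Type*} {G : SimpleGraph V}

theorem IsThetaDual.posSemidef_smul_diagonal_sub [DecidableEq V] {B : Matrix V V ℝ}
    (hB : IsThetaDual G B) {t : ℝ} {Y : Matrix V V ℝ} (hY : IsStrictVectorColoring G t Y) :
    (t • diagonal B.diag - B).PosSemidef := by
  have hBY : t • diagonal B.diag - B = B ⊙ Y := by
    ext i j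
    by_cases hij : i = j
    · subst hij
      simp only [Matrix.sub_apply, Matrix.smul_apply, diagonal_apply_eq, diag_apply, smul_eq_mul,
        hadamard_apply, hY.diag_eq]
      ring
    · by_cases hG : G.Adj i j
      · simp [hij, hY.adj_eq i j hG]
      · simp [hij, hB.eq_zero_of_not_adj i j hij hG]
  exact hBY ▸ hB.posSemidef.hadamard hY.posSemidef

variable [Fintype V]

theorem sum_sum_smul_diagonal_sub [DecidableEq V] (B : Matrix V V ℝ) (t : ℝ) :
    ∑ i, ∑ j, (t • diagonal B.diag - B) i j = t * B.trace - ∑ i, ∑ j, B i j := by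
  simp [diagonal_apply, trace, Finset.mul_sum]

theorem IsThetaDual.sum_sum_le {B : Matrix V V ℝ} (hB : IsThetaDual G B) {t : ℝ}
    {Y : Matrix V V ℝ} (hY : IsStrictVectorColoring G t Y) :
    ∑ i, ∑ j, B i j ≤ t * B.trace := by
  classical
  obtain ⟨m, x, hx⟩ := exists_eq_gram_of_posSemidef (hB.posSemidef_smul_diagonal_sub hY)
  rw [← sub_nonneg, ← sum_sum_smul_diagonal_sub, hx, sum_sum_gram]
  positivity

/-- The linear constraints and the objective of the dual program: the entries of a matrix that
`IsThetaDual` requires to vanish, and the sum of all entries. -/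
def thetaDualMap (G : SimpleGraph V) [DecidableEq V] [DecidableRel G.Adj] :
    Matrix V V ℝ →ₗ[ℝ] (V → V → ℝ) × ℝ where
  toFun B := (fun i j => if i = j ∨ G.Adj i j then 0 else B i j, ∑ i, ∑ j, B i j)
  map_add' A B := by
    ext
    · simp only [Matrix.add_apply, Prod.fst_add, Pi.add_apply]
      split_ifs <;> simp
    · simp [Finset.sum_add_distrib]
  map_smul' c B := by
    ext
    · simp
    · simp [Finset.mul_sum]

theorem thetaDualMap_single [DecidableEq V] [DecidableRel G.Adj] {i j : V}
    (h : i = j ∨ G.Adj i j) :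
    thetaDualMap G (Matrix.single i j 1) = (0, 1) := by
  ext k l
  · by_cases hkl : i = k ∧ j = l
    · obtain ⟨rfl, rfl⟩ := hkl
      simp [thetaDualMap, h]
    · simp [thetaDualMap, Matrix.single_apply, hkl]
  · simp [thetaDualMap, Matrix.single_apply, ite_and]

theorem exists_isStrictVectorColoring_of_le_mul_trace [DecidableEq V] {f : Matrix V V ℝ →ₗ[ℝ] ℝ}
    {a l : ℝ} (hl : 0 < l) (hf : ∀ B : Matrix V V ℝ, B.PosSemidef → f B ≤ a * B.trace)
    (hfl : ∀ i j, i = j ∨ G.Adj i j → f (Matrix.single i j 1) = l) :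
    ∃ Y, IsStrictVectorColoring G (a / l) Y := by
  refine ⟨_, (posSemidef_smul_one_sub_of_le_mul_trace hf).smul (inv_nonneg.2 hl.le),
    fun i => ?_, fun i j hij => ?_⟩
  · simp only [Matrix.smul_apply, Matrix.sub_apply, one_apply_eq, smul_eq_mul, mul_one, of_apply,
      hfl i i (.inl rfl), add_self_div_two]
    field_simp
  · simp [hij.ne, hfl i j (.inr hij), hfl j i (.inr hij.symm), hl.ne']

theorem exists_isThetaDual_of_mem_lowerBounds [Nonempty V] {t : ℝ}
    (ht : t ∈ lowerBounds (thetaBarValues G)) :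
    ∃ B, IsThetaDual G B ∧ B.trace = 1 ∧ t ≤ ∑ i, ∑ j, B i j := by
  classical
  by_contra! hB
  let L := thetaDualMap G
  have hdisj : Disjoint (L '' {B | B.PosSemidef ∧ B.trace = 1}) ({0} ×ˢ Set.Ici t) := by
    rw [Set.disjoint_left]
    rintro _ ⟨B, ⟨hpos, htr⟩, rfl⟩ ⟨hzero, hsum⟩
    refine (hB B ⟨hpos, fun i j hij hG => ?_⟩ htr).not_ge hsum
    simpa [L, thetaDualMap, hij, hG] using congrFun₂ hzero i j
  obtain ⟨f, a, b, hfa, hab, hfb⟩ := geometric_hahn_banach_compact_closed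
    (convex_setOf_posSemidef_trace_eq_one.linear_image L)
    (isCompact_setOf_posSemidef_trace_eq_one.image L.continuous_of_finiteDimensional)
    ((convex_singleton 0).prod (convex_Ici t)) (isClosed_singleton.prod isClosed_Ici) hdisj
  let l := f (0, 1)
  have hbl : ∀ s, t ≤ s → b < s * l := fun s hs => by
    have h := hfb (s • (0, 1)) ⟨by simp, by simpa using hs⟩
    rwa [map_smul] at h
  have hle : ∀ B : Matrix V V ℝ, B.PosSemidef → (f.toLinearMap ∘ₗ L) B ≤ a * B.trace := fun B =>
    le_mul_trace_of_forall_trace_eq_one fun B hpos htr => (hfa _ ⟨B, ⟨hpos, htr⟩, rfl⟩).le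
  have hfl : ∀ i j, i = j ∨ G.Adj i j → (f.toLinearMap ∘ₗ L) (Matrix.single i j 1) = l :=
    fun i j hij => congrArg f (thetaDualMap_single hij)
  have hla : l ≤ a := by
    obtain ⟨i⟩ := ‹Nonempty V›
    have hpos : (Matrix.single i i (1 : ℝ)).PosSemidef := by
      rw [← diagonal_single]
      exact .diagonal (Pi.single_nonneg.2 zero_le_one)
    simpa [hfl i i (.inl rfl)] using hle _ hpos
  have hl : 0 < l := by
    nlinarith [hbl (max t 1) (le_max_left t 1), le_max_right t 1]
  have hlt : t ≤ a / l := ht (mem_thetaBarValues_iff.2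
    (exists_isStrictVectorColoring_of_le_mul_trace hl hle hfl))
  rw [le_div_iff₀ hl] at hlt
  linarith [hbl t le_rfl]

end Duality

section Mycielskian

variable {V E F : Type*} [NormedAddCommGroup E] [InnerProductSpace ℝ E] [NormedAddCommGroup F]
  [InnerProductSpace ℝ F]

/-- The extension to `M(G)` of a family of vectors `x` indexed by the vertices of `G`: the level
`i` copy of `x v` is scaled by `c i`, and `z` is the vector at the extra vertex. -/
def mycielskianLift (c : Fin 2 → ℝ) (x : V → E) (z : E) : (V × Fin 2) ⊕ Unit → E :=
  Sum.elim (fun p => c p.2 • x p.1) fun _ => z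

@[simp]
theorem mycielskianLift_inl (c : Fin 2 → ℝ) (x : V → E) (z : E) (p : V × Fin 2) :
    mycielskianLift c x z (.inl p) = c p.2 • x p.1 :=
  rfl

@[simp]
theorem mycielskianLift_inr (c : Fin 2 → ℝ) (x : V → E) (z : E) (o : Unit) :
    mycielskianLift c x z (.inr o) = z :=
  rfl

theorem gram_mycielskianLift_inl_inl (c : Fin 2 → ℝ) (x : V → E) (z : E) (p q : V × Fin 2) :
    gram ℝ (mycielskianLift c x z) (.inl p) (.inl q) =
      c p.2 * c q.2 * inner ℝ (x p.1) (x q.1) := by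
  rw [gram_apply, mycielskianLift_inl, mycielskianLift_inl, real_inner_smul_left,
    real_inner_smul_right, mul_assoc]

theorem sum_mycielskianLift [Fintype V] (c : Fin 2 → ℝ) (x : V → E) (z : E) :
    ∑ a, mycielskianLift c x z a = (c 0 + c 1) • ∑ v, x v + z := by
  simp [Fintype.sum_prod_type, Finset.sum_add_distrib, Finset.smul_sum, add_smul]

theorem trace_gram_mycielskianLift [Fintype V] (c : Fin 2 → ℝ) (x : V → E) (z : E) :
    (gram ℝ (mycielskianLift c x z)).trace = (c 0 ^ 2 + c 1 ^ 2) * ∑ v, ‖x v‖ ^ 2 + ‖z‖ ^ 2 := by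
  simp [trace, Fintype.sum_prod_type, Finset.mul_sum, norm_smul, mul_pow, add_mul]

/-- The relations between `t`, the theta number `u + 1` of the Mycielskian of a graph with theta
number `t`, and the coefficients from which optimal solutions for the Mycielskian are built. -/
structure MycielskianCoeffs (t u k m r : ℝ) : Prop where
  one_le_t : 1 ≤ t
  one_le_u : 1 ≤ u
  mul_eq : k * t = u + 1
  sq_eq : m ^ 2 = u * (k - 1)
  add_mul_eq : m + u * r = u
  sq_mul_eq : r ^ 2 * (t - 1) * u = k * (u ^ 2 - 1)
  m_pos : 0 < m
  r_nonneg : 0 ≤ r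
  mul_le : r * (t - 1) * m ≤ k

variable {G : SimpleGraph V} {t u k m r : ℝ}

theorem MycielskianCoeffs.k_pos (hc : MycielskianCoeffs t u k m r) : 0 < k :=
  pos_of_mul_pos_left (by linarith [hc.mul_eq, hc.one_le_u])
    (zero_le_one.trans hc.one_le_t)

/-- An optimal strict vector colouring of `M(G)`, built from the vectors `y` of an optimal one of
`G`: the vector of `(v, i)` is the sum of a multiple of `y v` and a multiple of the vector of the
extra vertex, which is orthogonal to all `y v`. -/
noncomputable def mycielskianColoring (u k m r : ℝ) (y : V → E) :
    Matrix ((V × Fin 2) ⊕ Unit) ((V × Fin 2) ⊕ Unit) ℝ :=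
  u⁻¹ • gram ℝ (mycielskianLift ![m, -1] (fun _ => (1 : ℝ)) u) +
    k⁻¹ • gram ℝ (mycielskianLift ![k, r] y 0)

theorem mycielskianColoring_inl_inl (y : V → E) (p q : V × Fin 2) :
    mycielskianColoring u k m r y (.inl p) (.inl q) =
      u⁻¹ * (![m, -1] p.2 * ![m, -1] q.2) +
        k⁻¹ * (![k, r] p.2 * ![k, r] q.2 * inner ℝ (y p.1) (y q.1)) := by
  simp only [mycielskianColoring, Matrix.add_apply, Matrix.smul_apply, gram_mycielskianLift_inl_inl,
    RCLike.inner_apply, conj_trivial, mul_one, smul_eq_mul]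

theorem IsStrictVectorColoring.mycielskianColoring [Finite V] (hc : MycielskianCoeffs t u k m r)
    {y : V → E} (hY : IsStrictVectorColoring G t (gram ℝ y)) :
    IsStrictVectorColoring (mycielskian G) (u + 1) (mycielskianColoring u k m r y) := by
  have hu : 0 < u := zero_lt_one.trans_le hc.one_le_u
  have hk := hc.k_pos
  have hdiag : ∀ v, inner ℝ (y v) (y v) = t - 1 := hY.diag_eq
  have hadj : ∀ v w, G.Adj v w → inner ℝ (y v) (y w) = -1 := hY.adj_eq
  refine ⟨((posSemidef_gram ℝ _).smul (inv_nonneg.2 hu.le)).add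
    ((posSemidef_gram ℝ _).smul (inv_nonneg.2 hk.le)), ?_, ?_⟩
  · rintro (⟨v, i⟩ | o)
    · rw [mycielskianColoring_inl_inl, hdiag, add_sub_cancel_right]
      fin_cases i <;> simp only [Fin.zero_eta, Fin.mk_one, cons_val_zero, cons_val_one] <;>
        field_simp
      · linear_combination hc.sq_eq + hc.mul_eq * u
      · linear_combination hc.sq_mul_eq
    · simp [_root_.mycielskianColoring, sq, hu.ne']
  · rintro (⟨v, i⟩ | o) (⟨w, j⟩ | o') h
    · obtain ⟨hvw, hij⟩ := h
      rw [mycielskianColoring_inl_inl, hadj v w hvw]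
      obtain ⟨rfl, rfl⟩ | ⟨rfl, rfl⟩ | ⟨rfl, rfl⟩ :
          i = 0 ∧ j = 0 ∨ i = 0 ∧ j = 1 ∨ i = 1 ∧ j = 0 := by omega
      all_goals
        simp only [cons_val_zero, cons_val_one]
        field_simp
      · linear_combination hc.sq_eq
      · linear_combination -hc.add_mul_eq
      · linear_combination -hc.add_mul_eq
    · obtain rfl : i = 1 := h
      simp [_root_.mycielskianColoring, hu.ne']
    · obtain rfl : j = 1 := h
      simp [_root_.mycielskianColoring, hu.ne']
    · exact h.elim

/-- Gram vectors `g` of an optimal solution `B` of trace one of the dual program, of value `t`, and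
Gram vectors `f` of its slack matrix `t • diagonal B.diag - B`. -/
structure IsOptimalDualPair [Fintype V] [DecidableEq V] (G : SimpleGraph V) (t : ℝ) (f : V → E)
    (g : V → F) : Prop where
  isThetaDual : IsThetaDual G (gram ℝ g)
  trace_eq : (gram ℝ g).trace = 1
  sum_sum_eq : ∑ v, ∑ w, gram ℝ g v w = t
  slack_eq : gram ℝ f = t • diagonal (gram ℝ g).diag - gram ℝ g

theorem exists_isOptimalDualPair_thetaBar [Fintype V] [DecidableEq V] [Nonempty V]
    (G : SimpleGraph V) :
    ∃ (m n : ℕ) (f : V → EuclideanSpace ℝ (Fin m)) (g : V → EuclideanSpace ℝ (Fin n)),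
      IsOptimalDualPair G (thetaBar G) f g := by
  obtain ⟨Y, hY⟩ := exists_isStrictVectorColoring_thetaBar G
  obtain ⟨B, hB, htr, hle⟩ := exists_isThetaDual_of_mem_lowerBounds (isLeast_thetaBar G).2
  have hsum := hB.sum_sum_le hY
  rw [htr, mul_one] at hsum
  obtain ⟨m, f, hf⟩ := exists_eq_gram_of_posSemidef (hB.posSemidef_smul_diagonal_sub hY)
  obtain ⟨n, g, rfl⟩ := exists_eq_gram_of_posSemidef hB.posSemidef
  exact ⟨m, n, f, g, hB, htr, hsum.antisymm hle, hf.symm⟩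

namespace IsOptimalDualPair

variable [Fintype V] [DecidableEq V] {f : V → E} {g : V → F}

theorem inner_slack (h : IsOptimalDualPair G t f g) (v w : V) :
    inner ℝ (f v) (f w) = (if v = w then t * ‖g v‖ ^ 2 else 0) - inner ℝ (g v) (g w) := by
  simpa [gram_apply, diagonal_apply] using congrFun₂ h.slack_eq v w

theorem sum_norm_sq (h : IsOptimalDualPair G t f g) : ∑ v, ‖g v‖ ^ 2 = 1 := by
  simpa [trace, gram_apply] using h.trace_eq

theorem sum_slack (h : IsOptimalDualPair G t f g) : ∑ v, f v = 0 := by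
  rw [← norm_eq_zero, ← sq_eq_zero_iff, ← sum_sum_gram, h.slack_eq, sum_sum_smul_diagonal_sub,
    h.trace_eq, h.sum_sum_eq, mul_one, sub_self]

theorem inner_sum (h : IsOptimalDualPair G t f g) (v : V) :
    inner ℝ (g v) (∑ w, g w) = t * ‖g v‖ ^ 2 := by
  have hv : inner ℝ (f v) (∑ w, f w) = 0 := by rw [h.sum_slack, inner_zero_right]
  simp only [_root_.inner_sum, h.inner_slack, Finset.sum_sub_distrib, Finset.sum_ite_eq,
    Finset.mem_univ, if_true] at hv ⊢
  linarith

theorem norm_sum_sq (h : IsOptimalDualPair G t f g) : ‖∑ v, g v‖ ^ 2 = t := by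
  rw [← sum_sum_gram, h.sum_sum_eq]

theorem sum_norm_slack_sq (h : IsOptimalDualPair G t f g) : ∑ v, ‖f v‖ ^ 2 = t - 1 := by
  simp only [← real_inner_self_eq_norm_sq, h.inner_slack, if_true, Finset.sum_sub_distrib]
  simp only [real_inner_self_eq_norm_sq, ← Finset.mul_sum, h.sum_norm_sq, mul_one]

theorem inner_centered (h : IsOptimalDualPair G t f g) (v w : V) :
    inner ℝ (g v - ‖g v‖ ^ 2 • ∑ i, g i) (g w - ‖g w‖ ^ 2 • ∑ i, g i) =
      inner ℝ (g v) (g w) - t * ‖g v‖ ^ 2 * ‖g w‖ ^ 2 := by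
  rw [inner_sub_left, inner_sub_right, inner_sub_right, real_inner_smul_left,
    real_inner_smul_left, real_inner_smul_right, real_inner_smul_right,
    real_inner_comm (g w) (∑ i, g i), h.inner_sum, h.inner_sum, real_inner_self_eq_norm_sq,
    h.norm_sum_sq]
  ring

end IsOptimalDualPair

/-- An optimal solution, up to scaling, of the dual program for `M(G)`, built from an optimal pair
`f`, `g` for `G`. As `⟨f v, f w⟩ + ⟨g v, g w⟩ = 0` for `v ≠ w`, the weights can be chosen such that
the block of level `1` becomes diagonal. The last two Gram matrices come from splitting `g v` into
its components orthogonal and parallel to `∑ w, g w`; the parallel one is used to attach the extra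
vertex. -/
noncomputable def mycielskianDual [Fintype V] (t u k m r : ℝ) (f : V → E) (g : V → F) :
    Matrix ((V × Fin 2) ⊕ Unit) ((V × Fin 2) ⊕ Unit) ℝ :=
  k⁻¹ • gram ℝ (mycielskianLift ![-r, k] f 0) +
    (r * (t - 1) / m) • gram ℝ (mycielskianLift ![1, m] g 0) +
    (k - r * (t - 1) * m) •
      (gram ℝ (mycielskianLift ![0, 1] (fun v => g v - ‖g v‖ ^ 2 • ∑ w, g w) 0) +
        (t / u ^ 2) • gram ℝ (mycielskianLift ![0, u] (fun v => ‖g v‖ ^ 2) 1))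

theorem posSemidef_mycielskianDual [Fintype V] (hc : MycielskianCoeffs t u k m r) (f : V → E)
    (g : V → F) : (mycielskianDual t u k m r f g).PosSemidef := by
  have ht : 0 ≤ t - 1 := sub_nonneg.2 hc.one_le_t
  have ht' : 0 ≤ t := by linarith
  exact (((posSemidef_gram ℝ _).smul (inv_nonneg.2 hc.k_pos.le)).add
    ((posSemidef_gram ℝ _).smul (div_nonneg (mul_nonneg hc.r_nonneg ht) hc.m_pos.le))).add
    (((posSemidef_gram ℝ _).add ((posSemidef_gram ℝ _).smul (by positivity))).smul
      (sub_nonneg.2 hc.mul_le))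

namespace IsOptimalDualPair

variable [Fintype V] [DecidableEq V] {f : V → E} {g : V → F}

theorem mycielskianDual_inl_zero_inl_zero (h : IsOptimalDualPair G t f g) (v w : V) :
    mycielskianDual t u k m r f g (.inl (v, 0)) (.inl (w, 0)) =
      k⁻¹ * r ^ 2 * ((if v = w then t * ‖g v‖ ^ 2 else 0) - inner ℝ (g v) (g w)) +
        r * (t - 1) / m * inner ℝ (g v) (g w) := by
  simp only [mycielskianDual, Matrix.add_apply, Matrix.smul_apply, gram_mycielskianLift_inl_inl,
    h.inner_slack, cons_val_zero, smul_eq_mul, zero_mul, mul_zero]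
  ring

theorem mycielskianDual_inl_inl_of_ne (h : IsOptimalDualPair G t f g)
    (hc : MycielskianCoeffs t u k m r) (v w : V) {i j : Fin 2} (hij : i ≠ j) :
    mycielskianDual t u k m r f g (.inl (v, i)) (.inl (w, j)) =
      r * t * (inner ℝ (g v) (g w) - if v = w then ‖g v‖ ^ 2 else 0) := by
  have hk := hc.k_pos.ne'
  have hm := hc.m_pos.ne'
  simp only [mycielskianDual, Matrix.add_apply, Matrix.smul_apply, gram_mycielskianLift_inl_inl,
    h.inner_slack, smul_eq_mul]
  obtain ⟨rfl, rfl⟩ | ⟨rfl, rfl⟩ : i = 0 ∧ j = 1 ∨ i = 1 ∧ j = 0 := by omega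
  all_goals
    simp only [cons_val_zero, cons_val_one, zero_mul, mul_zero]
    field_simp
    split_ifs <;> ring

theorem mycielskianDual_inl_one_inl_one (h : IsOptimalDualPair G t f g)
    (hc : MycielskianCoeffs t u k m r) (v w : V) :
    mycielskianDual t u k m r f g (.inl (v, 1)) (.inl (w, 1)) =
      k * (if v = w then t * ‖g v‖ ^ 2 else 0) := by
  have hu : u ≠ 0 := (zero_lt_one.trans_le hc.one_le_u).ne'
  simp only [mycielskianDual, Matrix.add_apply, Matrix.smul_apply, gram_mycielskianLift_inl_inl,
    h.inner_slack, h.inner_centered, RCLike.inner_apply, conj_trivial, cons_val_one, cons_val_zero,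
    smul_eq_mul]
  field_simp
  ring

theorem isThetaDual_mycielskianDual (h : IsOptimalDualPair G t f g)
    (hc : MycielskianCoeffs t u k m r) :
    IsThetaDual (mycielskian G) (mycielskianDual t u k m r f g) := by
  have hg : ∀ v w, v ≠ w → ¬ G.Adj v w → inner ℝ (g v) (g w) = 0 :=
    h.isThetaDual.eq_zero_of_not_adj
  refine ⟨posSemidef_mycielskianDual hc f g, ?_⟩
  rintro (⟨v, i⟩ | o) (⟨w, j⟩ | o') hne hadj
  · rcases ne_or_eq i j with hij | rfl
    · rw [h.mycielskianDual_inl_inl_of_ne hc v w hij]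
      split_ifs with hvw
      · rw [hvw, real_inner_self_eq_norm_sq, sub_self, mul_zero]
      · have hG : ¬ G.Adj v w := fun hG => hadj ⟨hG, by omega⟩
        rw [hg v w hvw hG, sub_zero, mul_zero]
    · have hvw : v ≠ w := fun hvw => hne (by rw [hvw])
      fin_cases i
      · have hG : ¬ G.Adj v w := fun hG => hadj ⟨hG, .inl rfl⟩
        simp [h.mycielskianDual_inl_zero_inl_zero, hvw, hg v w hvw hG]
      · simp [h.mycielskianDual_inl_one_inl_one hc, hvw]
  · have hi : i ≠ 1 := hadj
    obtain rfl : i = 0 := by omega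
    simp [mycielskianDual]
  · have hj : j ≠ 1 := hadj
    obtain rfl : j = 0 := by omega
    simp [mycielskianDual]
  · exact absurd rfl hne

theorem sum_sum_mycielskianDual (h : IsOptimalDualPair G t f g) :
    ∑ a, ∑ b, mycielskianDual t u k m r f g a b =
      r * (t - 1) / m * ((1 + m) ^ 2 * t) + (k - r * (t - 1) * m) * (t / u ^ 2 * (u + 1) ^ 2) := by
  simp only [mycielskianDual, Matrix.add_apply, Matrix.smul_apply, Finset.sum_add_distrib,
    ← Finset.smul_sum, sum_sum_gram, sum_mycielskianLift, h.sum_slack, h.sum_norm_sq,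
    Finset.sum_sub_distrib, ← Finset.sum_smul]
  simp [norm_smul, mul_pow, h.norm_sum_sq]

theorem sum_norm_centered_sq (h : IsOptimalDualPair G t f g) :
    ∑ v, ‖g v - ‖g v‖ ^ 2 • ∑ w, g w‖ ^ 2 = 1 - t * ∑ v, ‖g v‖ ^ 4 := by
  simp only [← real_inner_self_eq_norm_sq (_ - _), h.inner_centered, Finset.sum_sub_distrib]
  simp only [real_inner_self_eq_norm_sq, h.sum_norm_sq, Finset.mul_sum, mul_assoc, ← pow_add]

theorem trace_mycielskianDual (h : IsOptimalDualPair G t f g) (hc : MycielskianCoeffs t u k m r) :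
    (mycielskianDual t u k m r f g).trace =
      k⁻¹ * r ^ 2 * (t - 1) + r * (t - 1) / m + (u + 1) +
        (k - r * (t - 1) * m) * (t / u ^ 2) := by
  have hu : u ≠ 0 := (zero_lt_one.trans_le hc.one_le_u).ne'
  have hk := hc.k_pos.ne'
  have hm := hc.m_pos.ne'
  simp only [mycielskianDual, trace_add, trace_smul, trace_gram_mycielskianLift,
    h.sum_norm_slack_sq, h.sum_norm_sq, h.sum_norm_centered_sq]
  simp only [cons_val_zero, cons_val_one, even_two, Even.neg_pow, norm_zero, norm_one, norm_pow,
    norm_norm, ← pow_mul, Nat.reduceMul, ne_eq, OfNat.ofNat_ne_zero, not_false_eq_true, zero_pow,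
    one_pow, add_zero, zero_add, mul_one, one_mul, smul_eq_mul]
  field_simp
  linear_combination k * m * u ^ 2 * hc.mul_eq

end IsOptimalDualPair

theorem MycielskianCoeffs.dual_value_eq (hc : MycielskianCoeffs t u k m r) :
    r * (t - 1) / m * ((1 + m) ^ 2 * t) + (k - r * (t - 1) * m) * (t / u ^ 2 * (u + 1) ^ 2) =
      (u + 1) * (k⁻¹ * r ^ 2 * (t - 1) + r * (t - 1) / m + (u + 1) +
        (k - r * (t - 1) * m) * (t / u ^ 2)) := by
  have hu : u ≠ 0 := (zero_lt_one.trans_le hc.one_le_u).ne'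
  have hk := hc.k_pos.ne'
  have hm := hc.m_pos.ne'
  have hsq : t * m ^ 2 = u * (u + 1 - t) := by linear_combination t * hc.sq_eq + u * hc.mul_eq
  have hr : t + m * t - (u + 1) = m * t * r := by
    refine mul_left_cancel₀ hu ?_
    linear_combination hsq - m * t * hc.add_mul_eq
  have hA : r * (t - 1) * u * (t + m * t - (u + 1)) = m * (u - 1) * (u + 1) ^ 2 := by
    rw [hr]
    linear_combination m * t * hc.sq_mul_eq + m * (u ^ 2 - 1) * hc.mul_eq
  have hslack : k⁻¹ * r ^ 2 * (t - 1) = (u ^ 2 - 1) / u := by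
    field_simp
    linear_combination hc.sq_mul_eq
  rw [hslack]
  field_simp
  linear_combination 2 * u * hA - u * r * (t - 1) * hsq + (u + 1) * u * m * hc.mul_eq

theorem MycielskianCoeffs.thetaBar_mycielskian [Finite V] [Nonempty V]
    (hc : MycielskianCoeffs (thetaBar G) u k m r) : thetaBar (mycielskian G) = u + 1 := by
  classical
  have := Fintype.ofFinite V
  obtain ⟨p, q, f, g, h⟩ := exists_isOptimalDualPair_thetaBar G
  obtain ⟨Y, hY⟩ := exists_isStrictVectorColoring_thetaBar G
  obtain ⟨n, y, rfl⟩ := exists_eq_gram_of_posSemidef hY.posSemidef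
  refine (isLeast_thetaBar _).unique ⟨mem_thetaBarValues_iff.2 ⟨_, hY.mycielskianColoring hc⟩, ?_⟩
  intro s hs
  obtain ⟨Z, hZ⟩ := mem_thetaBarValues_iff.1 hs
  have hle := (h.isThetaDual_mycielskianDual hc).sum_sum_le hZ
  rw [h.sum_sum_mycielskianDual, hc.dual_value_eq, ← h.trace_mycielskianDual hc] at hle
  refine le_of_mul_le_mul_right hle ?_
  rw [h.trace_mycielskianDual hc]
  have hk := hc.k_pos
  have hm := hc.m_pos
  have hr := hc.r_nonneg
  have ht : 0 ≤ thetaBar G - 1 := sub_nonneg.2 hc.one_le_t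
  have hslack : 0 ≤ k - r * (thetaBar G - 1) * m := sub_nonneg.2 hc.mul_le
  have ht' : 0 < thetaBar G := by linarith
  have hu : 0 < u := zero_lt_one.trans_le hc.one_le_u
  positivity

end Mycielskian

section MycielskianCubic

variable {t u : ℝ}

theorem mycielskian_cubic_eq_zero_iff {x : ℝ} :
    x ^ 3 + (t - 3) * x ^ 2 + (3 - 2 * t - t ^ 2) * x + (-t ^ 3 + 5 * t ^ 2 - 3 * t - 1) = 0 ↔
      (x - 1 + t) ^ 2 * (t - (x - 1)) = 4 * t * (t - 1) := by
  constructor <;> intro h <;> linear_combination -h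

theorem strictAntiOn_add_sq_mul_sub (ht : 0 ≤ t) :
    StrictAntiOn (fun w => (w + t) ^ 2 * (t - w)) (Set.Ici (t / 3)) := by
  intro v hv w hw hvw
  rw [Set.mem_Ici] at hv hw
  have hpos : 0 < w ^ 2 + w * v + v ^ 2 + t * (w + v) - t ^ 2 := by
    nlinarith [mul_nonneg ht (sub_nonneg.2 hv)]
  linarith [mul_pos (sub_pos.2 hvw) hpos]

theorem sub_one_lt_of_cubic (hu : t / 3 ≤ u)
    (h : (u + t) ^ 2 * (t - u) = 4 * t * (t - 1)) : t - 1 < u := by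
  by_contra! hle
  have := (strictAntiOn_add_sq_mul_sub (by linarith)).antitoneOn hu (hu.trans hle) hle
  simp only [h] at this
  linarith

theorem one_le_of_cubic (ht : 1 ≤ t) (hlt : t - 1 < u) (hut : u ≤ t)
    (h : (u + t) ^ 2 * (t - u) = 4 * t * (t - 1)) : 1 ≤ u := by
  have hfactor : 4 * t * (u + 1 - t) * (u - 1) = (t - u) ^ 3 := by linear_combination -h
  have hpos : 0 < 4 * t * (u + 1 - t) := mul_pos (by linarith) (by linarith)
  have : 0 ≤ u - 1 := nonneg_of_mul_nonneg_right
    (hfactor ▸ pow_nonneg (sub_nonneg.2 hut) 3) hpos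
  linarith

theorem sq_eq_of_cubic {M : ℝ} (hM : 2 * M = u ^ 2 - t ^ 2 + 2 * t)
    (h : (u + t) ^ 2 * (t - u) = 4 * t * (t - 1)) : M ^ 2 = t * u * (u + 1 - t) := by
  linear_combination (2 * M + (u ^ 2 - t ^ 2 + 2 * t)) / 4 * hM + (t - u) / 4 * h

theorem le_mul_of_cubic {M : ℝ} (hM : 2 * M = u ^ 2 - t ^ 2 + 2 * t) (ht : 1 ≤ t)
    (hlt : t - 1 < u) (hut : u ≤ t) (h : (u + t) ^ 2 * (t - u) = 4 * t * (t - 1)) :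
    M ≤ t * u := by
  have hu := one_le_of_cubic ht hlt hut h
  have hsq : 2 * (t - u) ≤ (u + t) ^ 2 := by nlinarith
  linarith [mul_le_mul_of_nonneg_right hsq (sub_nonneg.2 hut)]

theorem mul_sub_one_le_of_cubic {M : ℝ} (hM : 2 * M = u ^ 2 - t ^ 2 + 2 * t) (ht : 1 ≤ t)
    (hlt : t - 1 < u) (h : (u + t) ^ 2 * (t - u) = 4 * t * (t - 1)) :
    M * (t - 1) ≤ t * (u + 2 - t) := by
  have hgap : t * (u + 2 - t) - M * (t - 1) =
      2 * t * (1 - (t - u)) + t * (t - u) ^ 2 / 2 + (t - u) ^ 2 * (2 - (t - u)) / 4 := by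
    linear_combination (1 - t) / 2 * hM + h / 4
  have h1 : 0 ≤ 2 * t * (1 - (t - u)) := mul_nonneg (by linarith) (by linarith)
  have h2 : 0 ≤ (t - u) ^ 2 * (2 - (t - u)) := mul_nonneg (sq_nonneg _) (by linarith)
  have h3 : 0 ≤ t * (t - u) ^ 2 := by positivity
  linarith

theorem MycielskianCoeffs.of_cubic {M : ℝ} (hM : 2 * M = u ^ 2 - t ^ 2 + 2 * t) (ht : 1 ≤ t)
    (hlt : t - 1 < u) (hut : u ≤ t) (h : (u + t) ^ 2 * (t - u) = 4 * t * (t - 1)) :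
    MycielskianCoeffs t u ((u + 1) / t) (M / t) ((t * u - M) / (t * u)) := by
  have hu := one_le_of_cubic ht hlt hut h
  have ht0 : 0 < t := by linarith
  have hu0 : 0 < u := by linarith
  have hsq := sq_eq_of_cubic hM h
  have hpos : 0 < M := by nlinarith
  refine ⟨ht, hu, by field_simp, ?_, by field_simp; ring, ?_, by positivity, ?_, ?_⟩
  · field_simp
    linear_combination hsq
  · field_simp
    linear_combination (t - 1) * hsq - (t - 1) * t * u * hM + t * u * h
  · exact div_nonneg (sub_nonneg.2 (le_mul_of_cubic hM ht hlt hut h)) (by positivity)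
  · have hle := mul_le_mul_of_nonneg_left (mul_sub_one_le_of_cubic hM ht hlt h)
      (mul_pos ht0 hu0).le
    have hnum : (t * u - M) * (t - 1) * M ≤ t * u * (u + 1) := by
      linear_combination hle - (t - 1) * hsq
    calc (t * u - M) / (t * u) * (t - 1) * (M / t)
        = (t * u - M) * (t - 1) * M / (t * u * t) := by field_simp
      _ ≤ t * u * (u + 1) / (t * u * t) := by gcongr
      _ = (u + 1) / t := by field_simp

theorem cos_div_three_arccos_mem_Icc (a : ℝ) :
    Real.cos (1 / 3 * Real.arccos a) ∈ Set.Icc (1 / 2) 1 := by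
  have hpi := Real.arccos_le_pi a
  have h0 := Real.arccos_nonneg a
  refine ⟨?_, Real.cos_le_one _⟩
  rw [← Real.cos_pi_div_three]
  exact Real.cos_le_cos_of_nonneg_of_le_pi (by linarith) (by linarith [Real.pi_pos]) (by linarith)

theorem four_mul_cos_div_three_arccos {a : ℝ} (ha : a ∈ Set.Icc (-1) 1) :
    4 * Real.cos (1 / 3 * Real.arccos a) ^ 3 - 3 * Real.cos (1 / 3 * Real.arccos a) = a := by
  rw [← Real.cos_three_mul, ← mul_assoc, mul_one_div_cancel three_ne_zero, one_mul,
    Real.cos_arccos ha.1 ha.2]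

/-- The theta number of the Mycielskian of a graph, as a function of the theta number `t` of the
graph. -/
noncomputable def mycielskianTheta (t : ℝ) : ℝ :=
  4 / 3 * t * Real.cos (1 / 3 * Real.arccos (1 - 27 / (4 * t) + 27 / (4 * t ^ 2))) - 1 / 3 * t + 1

theorem one_sub_div_add_div_sq_mem_Icc (ht : 1 ≤ t) :
    1 - 27 / (4 * t) + 27 / (4 * t ^ 2) ∈ Set.Icc (-1) 1 := by
  have ht0 : 0 < t := by linarith
  have hsq : 1 - 27 / (4 * t) + 27 / (4 * t ^ 2) = (4 * t ^ 2 - 27 * t + 27) / (4 * t ^ 2) := by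
    field_simp
  have hpos : 0 < 4 * t ^ 2 := mul_pos four_pos (pow_pos ht0 2)
  rw [hsq, Set.mem_Icc, le_div_iff₀ hpos, div_le_one hpos]
  constructor <;> nlinarith [sq_nonneg (16 * t - 27)]

theorem mycielskianTheta_sub_one_mem_Icc (ht : 1 ≤ t) :
    mycielskianTheta t - 1 ∈ Set.Icc (t / 3) t := by
  obtain ⟨hc, hc'⟩ := cos_div_three_arccos_mem_Icc (1 - 27 / (4 * t) + 27 / (4 * t ^ 2))
  constructor <;> unfold mycielskianTheta <;> nlinarith

theorem mycielskianTheta_cubic (ht : 1 ≤ t) :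
    (mycielskianTheta t - 1 + t) ^ 2 * (t - (mycielskianTheta t - 1)) = 4 * t * (t - 1) := by
  have h := four_mul_cos_div_three_arccos (one_sub_div_add_div_sq_mem_Icc ht)
  rw [mycielskianTheta]
  generalize Real.cos (1 / 3 * Real.arccos (1 - 27 / (4 * t) + 27 / (4 * t ^ 2))) = c at h ⊢
  have ht0 : t ≠ 0 := by linarith
  have h' : (4 * c ^ 3 - 3 * c) * (4 * t ^ 2) = 4 * t ^ 2 - 27 * t + 27 := by
    rw [h]
    field_simp
  linear_combination (-4 / 27) * t * h'

theorem isGreatest_mycielskianTheta (ht : 1 ≤ t) :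
    IsGreatest {x : ℝ | x ^ 3 + (t - 3) * x ^ 2 + (3 - 2 * t - t ^ 2) * x +
      (-t ^ 3 + 5 * t ^ 2 - 3 * t - 1) = 0} (mycielskianTheta t) := by
  simp only [mycielskian_cubic_eq_zero_iff]
  refine ⟨mycielskianTheta_cubic ht, fun x hx => ?_⟩
  by_contra! hlt
  have hmem := (mycielskianTheta_sub_one_mem_Icc ht).1
  exact (strictAntiOn_add_sq_mul_sub (by linarith) hmem (hmem.trans (by linarith))
    (sub_lt_sub_right hlt 1)).ne (hx.trans (mycielskianTheta_cubic ht).symm)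

theorem thetaBar_mycielskian {V : Type*} [Finite V] [Nonempty V] (G : SimpleGraph V) :
    thetaBar (mycielskian G) = mycielskianTheta (thetaBar G) := by
  have ht := one_le_thetaBar G
  obtain ⟨hu, hut⟩ := mycielskianTheta_sub_one_mem_Icc ht
  have h := mycielskianTheta_cubic ht
  have hM := mul_div_cancel₀ ((mycielskianTheta (thetaBar G) - 1) ^ 2 - thetaBar G ^ 2 +
    2 * thetaBar G) (two_ne_zero' ℝ)
  rw [(MycielskianCoeffs.of_cubic hM ht (sub_one_lt_of_cubic hu h) hut h).thetaBar_mycielskian,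
    sub_add_cancel]

end MycielskianCubic

theorem theorem2 {V : Type*} [Finite V] [Nonempty V] (G : SimpleGraph V) :
    -- the minima that define both theta numbers are attained
    IsLeast (thetaBarValues G) (thetaBar G) ∧
    IsLeast (thetaBarValues (mycielskian G)) (thetaBar (mycielskian G)) ∧
    -- the formula
    thetaBar (mycielskian G) =
      4 / 3 * thetaBar G *
          Real.cos (1 / 3 *
            Real.arccos (1 - 27 / (4 * thetaBar G) + 27 / (4 * thetaBar G ^ 2))) -
        1 / 3 * thetaBar G + 1 ∧
    -- the value is the largest real root of the cubic
    IsGreatest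
      {x : ℝ | x ^ 3 + (thetaBar G - 3) * x ^ 2 + (3 - 2 * thetaBar G - thetaBar G ^ 2) * x +
        (-thetaBar G ^ 3 + 5 * thetaBar G ^ 2 - 3 * thetaBar G - 1) = 0}
      (thetaBar (mycielskian G)) := by
  refine ⟨isLeast_thetaBar G, isLeast_thetaBar _, thetaBar_mycielskian G, ?_⟩
  rw [thetaBar_mycielskian]
  exact isGreatest_mycielskianTheta (one_le_thetaBar G)
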